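/- All algebras are over $\mathbb C$ and need not be unital. Let $M(B)$ denote the multiplier algebra of an algebra $B$ with non-degenerate product, i.e. the unital algebra of pairs of linear maps $(L,R)$ on $B$, written $L(x)=mx$, $R(x)=xm$, with $m(xy)=(mx)y$, $(xy)m=x(ym)$ and $(xm)y=x(my)$. A multiplier Hopf algebra is a pair $(\mathscr A,\delta)$ where $\mathscr A$ is an algebra with non-degenerate product and $\delta\colon\mathscr A\to M(\mathscr A\otimes\mathscr A)$ is a homomorphism ($\otimes$ being the algebraic tensor product) such that $T_1(a\otimes b)=\delta(a)(1\otimes b)$ and $T_2(a\otimes b)=(a\otimes 1)\delta(b)$ define bijections of $\mathscr A\otimes\mathscr A$ onto itself and such that $T_2\otimes\mathrm{id}$ and $\mathrm{id}\otimes T_1$ commute on $\mathscr A\otimes\mathscr A\otimes\mathscr A$. Then $\delta$ extends uniquely to a unital homomorphism $\delta\colon M(\mathscr A)\to M(\mathscr A\otimes\mathscr A)$. A discrete quantum group is a multiplier Hopf algebra $(\mathscr A,\delta)$ in which $\mathscr A$ is a $*$-algebra, $\delta$ is a $*$-homomorphism, and $\mathscr A$ is (isomorphic as an algebra to) a direct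 sum of full matrix algebras. **Corollary.** Let $(\mathscr A,\delta)$ be a discrete quantum group with $\mathscr A$ infinite-dimensional. Then $(M(\mathscr A),\delta)$ is not a Hopf algebra; that is, there is no unital homomorphism $\Delta\colon M(\mathscr A)\to M(\mathscr A)\otimes M(\mathscr A)$ which makes $M(\mathscr A)$ a Hopf algebra (coassociative, with a counit and an antipode) and whose composition with the canonical map $M(\mathscr A)\otimes M(\mathscr A)\to M(\mathscr A\otimes\mathscr A)$ is the extended comultiplication $\delta$. -/

import Mathlib

open scoped TensorProduct

universe u

/-- The multiplier algebra `M(B)` of a (not necessarily unital) complex algebra `B`: pairs `(L, R)`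
of linear maps `B → B` ("left and right multiplication by the multiplier") satisfying
`L (x y) = L x * y`, `R (x y) = x * R y` and `(R x) y = x (L y)`, with the product
`(L, R) (L', R') = (L ∘ L', R' ∘ R)`. -/
def multiplierSubalgebra (B : Type u) [NonUnitalRing B] [Module ℂ B] [IsScalarTower ℂ B B]
    [SMulCommClass ℂ B B] :
    Subalgebra ℂ (Module.End ℂ B × (Module.End ℂ B)ᵐᵒᵖ) where
  carrier := {p | (∀ x y, p.1 (x * y) = p.1 x * y) ∧
    (∀ x y, p.2.unop (x * y) = x * p.2.unop y) ∧ ∀ x y, p.2.unop x * y = x * p.1 y}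
  mul_mem' := by
    rintro p q ⟨h1, h2, h3⟩ ⟨k1, k2, k3⟩
    refine ⟨fun x y => ?_, fun x y => ?_, fun x y => ?_⟩
    · simp [h1, k1]
    · simp [h2, k2]
    · simp [h3, k3]
  add_mem' := by
    rintro p q ⟨h1, h2, h3⟩ ⟨k1, k2, k3⟩
    refine ⟨fun x y => ?_, fun x y => ?_, fun x y => ?_⟩
    · simp [h1, k1, add_mul]
    · simp [h2, k2, mul_add]
    · simp [h3, k3, mul_add, add_mul]
  algebraMap_mem' := by
    intro c
    refine ⟨fun x y => ?_, fun x y => ?_, fun x y => ?_⟩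
    · simp [Module.algebraMap_end_apply, smul_mul_assoc]
    · simp [Module.algebraMap_end_apply, mul_smul_comm]
    · simp [Module.algebraMap_end_apply, smul_mul_assoc, mul_smul_comm]

/-- The multiplier algebra `M(B)`, a unital complex algebra. -/
abbrev Multiplier (B : Type u) [NonUnitalRing B] [Module ℂ B] [IsScalarTower ℂ B B]
    [SMulCommClass ℂ B B] : Type u :=
  multiplierSubalgebra B

namespace Multiplier

section General

variable {B : Type u} [NonUnitalRing B] [Module ℂ B] [IsScalarTower ℂ B B] [SMulCommClass ℂ B B]

/-- Left multiplication `x ↦ m x`. -/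
def left (m : Multiplier B) : Module.End ℂ B := m.1.1

/-- Right multiplication `x ↦ x m`. -/
def right (m : Multiplier B) : Module.End ℂ B := m.1.2.unop

/-- Build a multiplier from left and right multiplication maps. -/
def mk' (L R : Module.End ℂ B) (h1 : ∀ x y, L (x * y) = L x * y)
    (h2 : ∀ x y, R (x * y) = x * R y) (h3 : ∀ x y, R x * y = x * L y) : Multiplier B :=
  ⟨(L, MulOpposite.op R), h1, h2, h3⟩

theorem left_mul_apply (m : Multiplier B) (x y : B) : m.left (x * y) = m.left x * y := m.2.1 x y

theorem right_mul_apply (m : Multiplier B) (x y : B) : m.right (x * y) = x * m.right y :=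
  m.2.2.1 x y

theorem right_mul_eq (m : Multiplier B) (x y : B) : m.right x * y = x * m.left y := m.2.2.2 x y

theorem ext' {m n : Multiplier B} (h1 : ∀ x, m.left x = n.left x)
    (h2 : ∀ x, m.right x = n.right x) : m = n :=
  Subtype.ext (Prod.ext (LinearMap.ext h1) (MulOpposite.unop_injective (LinearMap.ext h2)))

@[simp] theorem left_mk' (L R : Module.End ℂ B) (h1 h2 h3) : (mk' L R h1 h2 h3).left = L := rfl
@[simp] theorem right_mk' (L R : Module.End ℂ B) (h1 h2 h3) : (mk' L R h1 h2 h3).right = R := rfl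
@[simp] theorem left_mul (m n : Multiplier B) : (m * n).left = m.left * n.left := rfl
@[simp] theorem right_mul (m n : Multiplier B) : (m * n).right = n.right * m.right := rfl
@[simp] theorem left_one : (1 : Multiplier B).left = 1 := rfl
@[simp] theorem right_one : (1 : Multiplier B).right = 1 := rfl
@[simp] theorem left_add (m n : Multiplier B) : (m + n).left = m.left + n.left := rfl
@[simp] theorem right_add (m n : Multiplier B) : (m + n).right = m.right + n.right := rfl
@[simp] theorem left_smul (c : ℂ) (m : Multiplier B) : (c • m).left = c • m.left := rfl
@[simp] theorem right_smul (c : ℂ) (m : Multiplier B) : (c • m).right = c • m.right := rfl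

variable (B) in
/-- The canonical homomorphism `B → M(B)`; it is injective when the product is non-degenerate. -/
def ι : B →ₙₐ[ℂ] Multiplier B where
  toFun b := mk' (LinearMap.mulLeft ℂ b) (LinearMap.mulRight ℂ b)
    (fun x y => by simp [mul_assoc]) (fun x y => by simp [mul_assoc])
    (fun x y => by simp [mul_assoc])
  map_smul' c b := ext' (fun x => smul_mul_assoc c b x) (fun x => mul_smul_comm c x b)
  map_zero' := ext' (fun x => zero_mul x) (fun x => mul_zero x)
  map_add' a b := ext' (fun x => add_mul a b x) (fun x => mul_add x a b)
  map_mul' a b := ext' (fun x => mul_assoc a b x) (fun x => (mul_assoc x a b).symm)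

@[simp] theorem left_ι (b x : B) : (ι B b).left x = b * x := rfl
@[simp] theorem right_ι (b x : B) : (ι B b).right x = x * b := rfl

theorem mul_ι (m : Multiplier B) (x : B) : m * ι B x = ι B (m.left x) :=
  ext' (fun y => left_mul_apply m x y) (fun y => right_mul_eq m y x)

theorem ι_mul (m : Multiplier B) (x : B) : ι B x * m = ι B (m.right x) :=
  ext' (fun y => (right_mul_eq m x y).symm) (fun y => right_mul_apply m y x)

end General

section Tensor

variable {A : Type u} [NonUnitalRing A] [Module ℂ A] [IsScalarTower ℂ A A] [SMulCommClass ℂ A A]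

/-- The multiplier `m ⊗ n` of `A ⊗ A`. -/
def tmul (m n : Multiplier A) : Multiplier (A ⊗[ℂ] A) :=
  mk' (TensorProduct.map m.left n.left) (TensorProduct.map m.right n.right)
    (fun x y => by
      induction x with
      | zero => simp
      | add x₁ x₂ h₁ h₂ => simp only [add_mul, map_add, h₁, h₂]
      | tmul a b =>
        induction y with
        | zero => simp
        | add x₁ x₂ h₁ h₂ => simp only [mul_add, map_add, h₁, h₂]
        | tmul c d => simp [left_mul_apply])
    (fun x y => by
      induction x with
      | zero => simp
      | add x₁ x₂ h₁ h₂ => simp only [add_mul, map_add, h₁, h₂]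
      | tmul a b =>
        induction y with
        | zero => simp
        | add x₁ x₂ h₁ h₂ => simp only [mul_add, map_add, h₁, h₂]
        | tmul c d => simp [right_mul_apply])
    (fun x y => by
      induction x with
      | zero => simp
      | add x₁ x₂ h₁ h₂ => simp only [add_mul, map_add, h₁, h₂]
      | tmul a b =>
        induction y with
        | zero => simp
        | add x₁ x₂ h₁ h₂ => simp only [mul_add, map_add, h₁, h₂]
        | tmul c d => simp [right_mul_eq])

@[simp] theorem left_tmul (m n : Multiplier A) :
    (tmul m n).left = TensorProduct.map m.left n.left := rfl

@[simp] theorem right_tmul (m n : Multiplier A) :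
    (tmul m n).right = TensorProduct.map m.right n.right := rfl

variable (A) in
/-- The canonical map `M(A) ⊗ M(A) → M(A ⊗ A)` through which `M(A) ⊗ M(A)` is regarded as a
subspace of `M(A ⊗ A)`. -/
noncomputable def tensorMap : Multiplier A ⊗[ℂ] Multiplier A →ₗ[ℂ] Multiplier (A ⊗[ℂ] A) :=
  TensorProduct.lift (LinearMap.mk₂ ℂ tmul
    (fun m m' n => ext' (fun x => by simp [TensorProduct.map_add_left])
      (fun x => by simp [TensorProduct.map_add_left]))
    (fun c m n => ext' (fun x => by simp [TensorProduct.map_smul_left])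
      (fun x => by simp [TensorProduct.map_smul_left]))
    (fun m n n' => ext' (fun x => by simp [TensorProduct.map_add_right])
      (fun x => by simp [TensorProduct.map_add_right]))
    (fun c m n => ext' (fun x => by simp [TensorProduct.map_smul_right])
      (fun x => by simp [TensorProduct.map_smul_right])))

end Tensor

section Nondegenerate

theorem eq_zero_of_slices_left {A : Type u} [AddCommGroup A] [Module ℂ A] (X : A ⊗[ℂ] A)
    (h : ∀ g : A →ₗ[ℂ] ℂ, TensorProduct.lid ℂ A (g.rTensor A X) = 0) : X = 0 := by
  classical
  let b := Module.Basis.ofVectorSpace ℂ A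
  apply (TensorProduct.equivFinsuppOfBasisLeft (N := A) b).injective
  ext i
  simpa [TensorProduct.equivFinsuppOfBasisLeft_apply] using h (b.coord i)

theorem eq_zero_of_slices_right {A : Type u} [AddCommGroup A] [Module ℂ A] (X : A ⊗[ℂ] A)
    (h : ∀ g : A →ₗ[ℂ] ℂ, TensorProduct.rid ℂ A (g.lTensor A X) = 0) : X = 0 := by
  classical
  let b := Module.Basis.ofVectorSpace ℂ A
  apply (TensorProduct.equivFinsuppOfBasisRight (M := A) b).injective
  ext i
  simpa [TensorProduct.equivFinsuppOfBasisRight_apply] using h (b.coord i)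

variable {A : Type u} [NonUnitalRing A] [Module ℂ A] [IsScalarTower ℂ A A] [SMulCommClass ℂ A A]

theorem tensor_eq_zero (h : ∀ a : A, (∀ b, a * b = 0) → a = 0) (X : A ⊗[ℂ] A)
    (hX : ∀ y, X * y = 0) : X = 0 := by
  refine eq_zero_of_slices_left X fun g => h _ fun b => ?_
  have e1 : ∀ Z : A ⊗[ℂ] A, TensorProduct.lid ℂ A (g.rTensor A Z) * b =
      TensorProduct.lid ℂ A (g.rTensor A ((LinearMap.mulRight ℂ b).lTensor A Z)) := by
    intro Z
    induction Z with
    | zero => simp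
    | add x₁ x₂ h₁ h₂ => simp only [add_mul, map_add, h₁, h₂]
    | tmul a c => simp [smul_mul_assoc]
  have e2 : (LinearMap.mulRight ℂ b).lTensor A X = 0 := by
    refine eq_zero_of_slices_right _ fun k => h _ fun a => ?_
    have e3 : ∀ Z : A ⊗[ℂ] A,
        TensorProduct.rid ℂ A (k.lTensor A ((LinearMap.mulRight ℂ b).lTensor A Z)) * a =
        TensorProduct.rid ℂ A (k.lTensor A (Z * (a ⊗ₜ b))) := by
      intro Z
      induction Z with
      | zero => simp
      | add x₁ x₂ h₁ h₂ => simp only [add_mul, map_add, h₁, h₂]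
      | tmul a c => simp [smul_mul_assoc]
    rw [e3, hX, map_zero, map_zero]
  rw [e1, e2, map_zero, map_zero]

theorem ι_tensor_injective (h : ∀ a : A, (∀ b, a * b = 0) → a = 0) :
    Function.Injective (ι (A ⊗[ℂ] A)) := by
  intro X Y hXY
  refine sub_eq_zero.1 (tensor_eq_zero h _ fun y => ?_)
  have := congrArg (fun m => left m y) hXY
  simp only [left_ι] at this
  rw [sub_mul, this, sub_self]

end Nondegenerate

end Multiplier

/-- A multiplier Hopf algebra structure on the complex algebra `A`. The maps `T₁`, `T₂` are
determined by the comultiplication (`A ⊗ A → M(A ⊗ A)` is injective because the product is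
non-degenerate), so that the fields `T₁` and `T₂` say that `a ⊗ b ↦ δ(a)(1 ⊗ b)` and
`a ⊗ b ↦ (a ⊗ 1)δ(b)` are bijections onto `A ⊗ A`. -/
structure MultiplierHopfAlgebra (A : Type u) [NonUnitalRing A] [Module ℂ A]
    [IsScalarTower ℂ A A] [SMulCommClass ℂ A A] where
  /-- the product is non-degenerate -/
  eq_zero_of_mul_right : ∀ a : A, (∀ b, a * b = 0) → a = 0
  /-- the product is non-degenerate -/
  eq_zero_of_mul_left : ∀ a : A, (∀ b, b * a = 0) → a = 0
  /-- the comultiplication `δ : A → M(A ⊗ A)` -/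
  comul : A →ₙₐ[ℂ] Multiplier (A ⊗[ℂ] A)
  /-- `a ⊗ b ↦ δ(a)(1 ⊗ b)` -/
  T₁ : (A ⊗[ℂ] A) ≃ₗ[ℂ] (A ⊗[ℂ] A)
  /-- `a ⊗ b ↦ (a ⊗ 1)δ(b)` -/
  T₂ : (A ⊗[ℂ] A) ≃ₗ[ℂ] (A ⊗[ℂ] A)
  T₁_tmul : ∀ a b : A, Multiplier.ι (A ⊗[ℂ] A) (T₁ (a ⊗ₜ b)) =
    comul a * Multiplier.tmul 1 (Multiplier.ι A b)
  T₂_tmul : ∀ a b : A, Multiplier.ι (A ⊗[ℂ] A) (T₂ (a ⊗ₜ b)) =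
    Multiplier.tmul (Multiplier.ι A a) 1 * comul b
  /-- coassociativity: `T₂ ⊗ id` and `id ⊗ T₁` commute on `A ⊗ A ⊗ A` -/
  coassoc : ∀ x : A ⊗[ℂ] (A ⊗[ℂ] A),
    TensorProduct.assoc ℂ A A A (T₂.toLinearMap.rTensor A
        ((TensorProduct.assoc ℂ A A A).symm (T₁.toLinearMap.lTensor A x))) =
      T₁.toLinearMap.lTensor A (TensorProduct.assoc ℂ A A A
        (T₂.toLinearMap.rTensor A ((TensorProduct.assoc ℂ A A A).symm x)))

namespace MultiplierHopfAlgebra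

variable {A : Type u} [NonUnitalRing A] [Module ℂ A] [IsScalarTower ℂ A A] [SMulCommClass ℂ A A]

theorem T₁_tmul_mul (H : MultiplierHopfAlgebra A) (a b : A) (x : A ⊗[ℂ] A) :
    H.T₁ (a ⊗ₜ b) * x = (H.comul a).left ((Multiplier.tmul 1 (Multiplier.ι A b)).left x) :=
  congrArg (fun m => Multiplier.left m x) (H.T₁_tmul a b)

theorem mul_T₂_tmul (H : MultiplierHopfAlgebra A) (a b : A) (x : A ⊗[ℂ] A) :
    x * H.T₂ (a ⊗ₜ b) = (H.comul b).right ((Multiplier.tmul (Multiplier.ι A a) 1).right x) :=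
  congrArg (fun m => Multiplier.right m x) (H.T₂_tmul a b)

theorem ι_injective (H : MultiplierHopfAlgebra A) :
    Function.Injective (Multiplier.ι (A ⊗[ℂ] A)) :=
  Multiplier.ι_tensor_injective H.eq_zero_of_mul_right

/-- Left multiplication by `δ(m)`: `δ(m) · δ(a)(1 ⊗ b) = δ(ma)(1 ⊗ b)`. -/
noncomputable def extLeft (H : MultiplierHopfAlgebra A) (m : Multiplier A) :
    Module.End ℂ (A ⊗[ℂ] A) :=
  H.T₁.toLinearMap ∘ₗ m.left.rTensor A ∘ₗ H.T₁.symm.toLinearMap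

/-- Right multiplication by `δ(m)`: `(a ⊗ 1)δ(b) · δ(m) = (a ⊗ 1)δ(bm)`. -/
noncomputable def extRight (H : MultiplierHopfAlgebra A) (m : Multiplier A) :
    Module.End ℂ (A ⊗[ℂ] A) :=
  H.T₂.toLinearMap ∘ₗ m.right.lTensor A ∘ₗ H.T₂.symm.toLinearMap

theorem extLeft_T₁ (H : MultiplierHopfAlgebra A) (m : Multiplier A) (a b : A) :
    H.extLeft m (H.T₁ (a ⊗ₜ b)) = H.T₁ (m.left a ⊗ₜ b) := by
  simp [extLeft]

theorem extRight_T₂ (H : MultiplierHopfAlgebra A) (m : Multiplier A) (a b : A) :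
    H.extRight m (H.T₂ (a ⊗ₜ b)) = H.T₂ (a ⊗ₜ m.right b) := by
  simp [extRight]

theorem comul_left_T₁ (H : MultiplierHopfAlgebra A) (a c d : A) :
    (H.comul a).left (H.T₁ (c ⊗ₜ d)) = H.T₁ ((a * c) ⊗ₜ d) := by
  apply H.ι_injective
  rw [← Multiplier.mul_ι, H.T₁_tmul, H.T₁_tmul, map_mul, mul_assoc]

theorem comul_right_T₂ (H : MultiplierHopfAlgebra A) (a c d : A) :
    (H.comul a).right (H.T₂ (c ⊗ₜ d)) = H.T₂ (c ⊗ₜ (d * a)) := by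
  apply H.ι_injective
  rw [← Multiplier.ι_mul, H.T₂_tmul, H.T₂_tmul, map_mul, mul_assoc]

theorem T₁_induction (H : MultiplierHopfAlgebra A) {p : A ⊗[ℂ] A → Prop} (h0 : p 0)
    (hadd : ∀ x y, p x → p y → p (x + y)) (ht : ∀ a b, p (H.T₁ (a ⊗ₜ b))) (x) : p x := by
  obtain ⟨z, rfl⟩ := H.T₁.surjective x
  induction z with
  | zero => simpa using h0
  | add x y hx hy => simpa using hadd _ _ hx hy
  | tmul a b => exact ht a b

theorem T₂_induction (H : MultiplierHopfAlgebra A) {p : A ⊗[ℂ] A → Prop} (h0 : p 0)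
    (hadd : ∀ x y, p x → p y → p (x + y)) (ht : ∀ a b, p (H.T₂ (a ⊗ₜ b))) (x) : p x := by
  obtain ⟨z, rfl⟩ := H.T₂.surjective x
  induction z with
  | zero => simpa using h0
  | add x y hx hy => simpa using hadd _ _ hx hy
  | tmul a b => exact ht a b

theorem extLeft_comul (H : MultiplierHopfAlgebra A) (m : Multiplier A) (a : A) (z : A ⊗[ℂ] A) :
    H.extLeft m ((H.comul a).left z) = (H.comul (m.left a)).left z := by
  induction z using H.T₁_induction with
  | h0 => simp
  | hadd x y hx hy => simp only [map_add, hx, hy]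
  | ht c d => rw [comul_left_T₁, comul_left_T₁, extLeft_T₁, Multiplier.left_mul_apply]

theorem extRight_comul (H : MultiplierHopfAlgebra A) (m : Multiplier A) (a : A) (z : A ⊗[ℂ] A) :
    H.extRight m ((H.comul a).right z) = (H.comul (m.right a)).right z := by
  induction z using H.T₂_induction with
  | h0 => simp
  | hadd x y hx hy => simp only [map_add, hx, hy]
  | ht c d => rw [comul_right_T₂, comul_right_T₂, extRight_T₂, Multiplier.right_mul_apply]

/-- The unique extension of the comultiplication to a unital homomorphism `M(A) → M(A ⊗ A)`;
it satisfies `δ(m)δ(a) = δ(ma)` and `δ(a)δ(m) = δ(am)`. -/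
noncomputable def comulExt (H : MultiplierHopfAlgebra A) :
    Multiplier A →ₐ[ℂ] Multiplier (A ⊗[ℂ] A) :=
  AlgHom.ofLinearMap
    { toFun := fun m => Multiplier.mk' (H.extLeft m) (H.extRight m)
        (fun x y => by
          induction x using H.T₁_induction with
          | h0 => simp
          | hadd x x' hx hy => simp only [map_add, add_mul, hx, hy]
          | ht a b => rw [T₁_tmul_mul, extLeft_comul, extLeft_T₁, T₁_tmul_mul])
        (fun y x => by
          induction x using H.T₂_induction with
          | h0 => simp
          | hadd x x' hx hy => simp only [map_add, mul_add, hx, hy]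
          | ht a b => rw [mul_T₂_tmul, extRight_comul, extRight_T₂, mul_T₂_tmul])
        (fun x y => by
          induction x using H.T₂_induction with
          | h0 => simp
          | hadd x x' hx hy => simp only [map_add, add_mul, hx, hy]
          | ht a b =>
            induction y using H.T₁_induction with
            | h0 => simp
            | hadd x x' hx hy => simp only [map_add, mul_add, hx, hy]
            | ht c d =>
              apply H.ι_injective
              rw [extRight_T₂, extLeft_T₁, map_mul, map_mul, T₁_tmul, T₁_tmul, T₂_tmul, T₂_tmul]
              have := congrArg H.comul (m.right_mul_eq b c)
              rw [map_mul, map_mul] at this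
              simp only [mul_assoc]
              rw [← mul_assoc (H.comul _) (H.comul _), this, mul_assoc])
      map_add' := fun m n => Multiplier.ext'
        (fun x => by simp [extLeft, LinearMap.rTensor_add])
        (fun x => by simp [extRight, LinearMap.lTensor_add])
      map_smul' := fun c m => Multiplier.ext'
        (fun x => by simp [extLeft, LinearMap.rTensor_smul])
        (fun x => by simp [extRight, LinearMap.lTensor_smul]) }
    (Multiplier.ext' (fun x => by simp [extLeft, Module.End.one_eq_id])
      (fun x => by simp [extRight, Module.End.one_eq_id]))
    (fun m n => Multiplier.ext'
      (fun x => by simp [extLeft, Module.End.mul_eq_comp, LinearMap.rTensor_comp])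
      (fun x => by simp [extRight, Module.End.mul_eq_comp, LinearMap.lTensor_comp]))

theorem comulExt_ι (H : MultiplierHopfAlgebra A) (a : A) :
    H.comulExt (Multiplier.ι A a) = H.comul a := by
  refine Multiplier.ext' (fun x => ?_) (fun x => ?_)
  · change H.extLeft _ x = _
    induction x using H.T₁_induction with
    | h0 => simp
    | hadd x y hx hy => simp only [map_add, hx, hy]
    | ht c d => rw [comul_left_T₁, extLeft_T₁]; rfl
  · change H.extRight _ x = _
    induction x using H.T₂_induction with
    | h0 => simp
    | hadd x y hx hy => simp only [map_add, hx, hy]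
    | ht c d => rw [comul_right_T₂, extRight_T₂]; rfl

theorem comulExt_unique (H : MultiplierHopfAlgebra A)
    (D : Multiplier A →ₐ[ℂ] Multiplier (A ⊗[ℂ] A))
    (hD : ∀ a, D (Multiplier.ι A a) = H.comul a) : D = H.comulExt := by
  refine AlgHom.ext fun m => Multiplier.ext' (fun x => ?_) (fun x => ?_)
  · change _ = H.extLeft _ x
    induction x using H.T₁_induction with
    | h0 => simp
    | hadd x y hx hy => simp only [map_add, hx, hy]
    | ht c d =>
      apply H.ι_injective
      rw [extLeft_T₁, ← Multiplier.mul_ι, H.T₁_tmul, H.T₁_tmul, ← hD, ← hD, ← mul_assoc,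
        ← map_mul, Multiplier.mul_ι]
  · change _ = H.extRight _ x
    induction x using H.T₂_induction with
    | h0 => simp
    | hadd x y hx hy => simp only [map_add, hx, hy]
    | ht c d =>
      apply H.ι_injective
      rw [extRight_T₂, ← Multiplier.ι_mul, H.T₂_tmul, H.T₂_tmul, ← hD, ← hD, mul_assoc,
        ← map_mul, Multiplier.ι_mul]

end MultiplierHopfAlgebra

/-- `A` is (isomorphic, as a complex algebra, to) the direct sum of a family of full matrix
algebras `M_{n i}(ℂ)`, `n i ≥ 1`, with componentwise product. -/
def IsDirectSumOfMatrixAlgebras (A : Type u) [NonUnitalRing A] [Module ℂ A] : Prop :=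
  ∃ (I : Type u) (n : I → ℕ) (e : A ≃ₗ[ℂ] Π₀ i, Matrix (Fin (n i)) (Fin (n i)) ℂ),
    (∀ i, 0 < n i) ∧ ∀ a b i, e (a * b) i = e a i * e b i

/-- A discrete quantum group: a multiplier Hopf `*`-algebra whose underlying algebra is a direct
sum of full matrix algebras. The adjoint of a multiplier `m` is the multiplier with
`m* x = (x* m)*` and `x m* = (m x*)*`. -/
structure DiscreteQuantumGroup (A : Type u) [NonUnitalRing A] [StarRing A] [Module ℂ A]
    [StarModule ℂ A] [IsScalarTower ℂ A A] [SMulCommClass ℂ A A]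
    extends MultiplierHopfAlgebra A where
  /-- `δ(a*) = δ(a)*`, left multiplication -/
  comul_star_left : ∀ (a : A) (x : A ⊗[ℂ] A),
    (comul (star a)).left x = star ((comul a).right (star x))
  /-- `δ(a*) = δ(a)*`, right multiplication -/
  comul_star_right : ∀ (a : A) (x : A ⊗[ℂ] A),
    (comul (star a)).right x = star ((comul a).left (star x))
  isDirectSum : IsDirectSumOfMatrixAlgebras A

/-- The unital complex algebra `B` is a Hopf algebra with comultiplication `Δ`: `Δ` (a unital
homomorphism) is coassociative and there are a counit (a unital homomorphism) and an antipode. -/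
def IsHopfAlgebra {B : Type u} [Ring B] [Algebra ℂ B] (Δ : B →ₐ[ℂ] B ⊗[ℂ] B) : Prop :=
  (∀ x, TensorProduct.assoc ℂ B B B (Δ.toLinearMap.rTensor B (Δ x)) =
    Δ.toLinearMap.lTensor B (Δ x)) ∧
  ∃ (ε : B →ₐ[ℂ] ℂ) (S : B →ₗ[ℂ] B),
    (∀ x, ε.toLinearMap.rTensor B (Δ x) = 1 ⊗ₜ x) ∧
    (∀ x, ε.toLinearMap.lTensor B (Δ x) = x ⊗ₜ 1) ∧
    (∀ x, LinearMap.mul' ℂ B (S.rTensor B (Δ x)) = algebraMap ℂ B (ε x)) ∧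
    ∀ x, LinearMap.mul' ℂ B (S.lTensor B (Δ x)) = algebraMap ℂ B (ε x)

/-! If the extended comultiplication took values in `M(A) ⊗ M(A)`, then for a nonzero `a` in `A` the
element `δ(a)` would come from a finite sum of elementary tensors of multipliers. Slicing its first
leg by functionals `m ↦ φ(b m c)` then gives multipliers in one finite-dimensional space. These
slices act on `A` as left multiplication by slices of `(b ⊗ 1)δ(a)`, which lie in `A`, so they fill
only a finite-dimensional `W ⊆ A` (`exists_finiteDimensional_right_leg`).

Local units supply `e` with `w e = w` on `W`, whence `(b ⊗ 1)δ(a)(c ⊗ (ey - y)) = 0` for all `b`,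
`c`, `y`. Non-degeneracy removes `b` and `c`, leaving `T₁ (a ⊗ (ey - y)) = 0`. Injectivity of `T₁`
and `a ≠ 0` force `ey = y` (`exists_left_unit`). A direct sum of matrix algebras with a left unit
has only finitely many blocks, so `A` would be finite-dimensional. -/

/-! ### Direct sums of matrix algebras: local units and finiteness. -/

section DirectSum

variable {A : Type u} [NonUnitalRing A] [Module ℂ A]

/-- A direct sum of matrix algebras has local units. -/
theorem IsDirectSumOfMatrixAlgebras.exists_right_unit (h : IsDirectSumOfMatrixAlgebras A)
    (W : Submodule ℂ A) [FiniteDimensional ℂ W] : ∃ e : A, ∀ w ∈ W, w * e = w := by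
  classical
  obtain ⟨I, n, f, -, hmul⟩ := h
  obtain ⟨S, hS⟩ := (Submodule.fg_iff_finiteDimensional W).2 inferInstance
  -- The finitely many blocks met by a finite spanning set of `W`.
  let s : Finset I := S.biUnion fun w => (f w).support
  have hs : ∀ w ∈ W, ∀ i ∉ s, f w i = 0 := by
    intro w hw i hi
    rw [← hS] at hw
    induction hw using Submodule.span_induction with
    | mem x hx =>
      by_contra hne
      exact hi (Finset.mem_biUnion.2 ⟨x, hx, DFinsupp.mem_support_iff.2 hne⟩)
    | zero => simp
    | add x y _ _ hx hy => simp [hx, hy]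
    | smul c x _ hx => simp [hx]
  -- The local unit is the identity matrix in each block of `s` and zero in the others.
  refine ⟨f.symm (DFinsupp.mk s fun i => 1), fun w hw => f.injective (DFinsupp.ext fun i => ?_)⟩
  rw [hmul, LinearEquiv.apply_symm_apply, DFinsupp.mk_apply]
  split_ifs with hi
  · rw [mul_one]
  · rw [mul_zero, hs w hw i hi]

/-- A direct sum of matrix algebras which has a left unit is finite-dimensional. -/
theorem IsDirectSumOfMatrixAlgebras.finiteDimensional (h : IsDirectSumOfMatrixAlgebras A)
    {e : A} (he : ∀ b, e * b = b) : FiniteDimensional ℂ A := by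
  classical
  obtain ⟨I, n, f, hn, hmul⟩ := h
  have hI : Finite I := by
    -- Every index lies in the finite support of `e`: if the block `i` of `e` vanished, `e` would
    -- annihilate the identity matrix of that block, which is nonzero since `0 < n i`.
    refine Set.finite_univ_iff.1 ((f e).support.finite_toSet.subset fun i _ => ?_)
    refine Finset.mem_coe.2 (DFinsupp.mem_support_iff.2 fun h0 => ?_)
    have : NeZero (n i) := ⟨(hn i).ne'⟩
    have h1 := hmul e (f.symm (DFinsupp.single i 1)) i
    rw [he, LinearEquiv.apply_symm_apply, DFinsupp.single_eq_same, h0, zero_mul] at h1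
    exact one_ne_zero h1
  have := Fintype.ofFinite I
  exact Module.Finite.equiv
    (f.trans (DFinsupp.linearEquivFunOnFintype (R := ℂ))).symm

end DirectSum

/-! ### Slices of tensors and of multipliers. -/

/-- The left slices of a tensor span a finite-dimensional space. -/
theorem exists_finiteDimensional_slices_mem {V W : Type*} [AddCommGroup V] [Module ℂ V]
    [AddCommGroup W] [Module ℂ W] (X : V ⊗[ℂ] W) :
    ∃ F : Submodule ℂ W, FiniteDimensional ℂ F ∧
      ∀ g : V →ₗ[ℂ] ℂ, TensorProduct.lid ℂ W (g.rTensor W X) ∈ F := by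
  induction X with
  | zero => exact ⟨⊥, inferInstance, fun g => by simp⟩
  | tmul v w =>
    exact ⟨ℂ ∙ w, inferInstance, fun g => by
      simpa using Submodule.smul_mem _ _ (Submodule.mem_span_singleton_self w)⟩
  | add X Y hX hY =>
    obtain ⟨F, hF, hX⟩ := hX
    obtain ⟨F', hF', hY⟩ := hY
    refine ⟨F ⊔ F', inferInstance, fun g => ?_⟩
    rw [map_add, map_add]
    exact Submodule.add_mem_sup (hX g) (hY g)

namespace Multiplier

variable {A : Type u} [NonUnitalRing A] [Module ℂ A] [IsScalarTower ℂ A A] [SMulCommClass ℂ A A]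

/-- The functional `m ↦ φ (m c)` on the multiplier algebra. -/
def evalFunctional (φ : A →ₗ[ℂ] ℂ) (c : A) : Multiplier A →ₗ[ℂ] ℂ where
  toFun m := φ (m.left c)
  map_add' m n := by simp
  map_smul' r m := by simp

/-- Left multiplication, as a linear map in the multiplier. -/
def leftLinear : Multiplier A →ₗ[ℂ] Module.End ℂ A where
  toFun m := m.left
  map_add' _ _ := rfl
  map_smul' _ _ := rfl

/-- On `m ⊗ n` both sides are `φ(m c) n y`. The multiplier on the right depends on `φ`, `c` and `X`
but not on `y`, and it is itself a slice of `X`. -/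
theorem slice_tensorMap_left (X : Multiplier A ⊗[ℂ] Multiplier A) (φ : A →ₗ[ℂ] ℂ) (c y : A) :
    TensorProduct.lid ℂ A (φ.rTensor A ((tensorMap A X).left (c ⊗ₜ y))) =
      (TensorProduct.lid ℂ (Multiplier A)
        ((evalFunctional φ c).rTensor (Multiplier A) X)).left y := by
  induction X with
  | zero =>
    rw [LinearMap.map_zero, LinearMap.map_zero, LinearEquiv.map_zero]
    change TensorProduct.lid ℂ A (φ.rTensor A 0) = 0
    rw [LinearMap.map_zero, LinearEquiv.map_zero]
  | add X Y hX hY => simp only [map_add, left_add, LinearMap.add_apply, hX, hY]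
  | tmul m n => simp [tensorMap, evalFunctional]

theorem slice_mul_tmul (Z : A ⊗[ℂ] A) (φ : A →ₗ[ℂ] ℂ) (c y : A) :
    TensorProduct.lid ℂ A (φ.rTensor A (Z * c ⊗ₜ y)) =
      TensorProduct.lid ℂ A ((φ ∘ₗ LinearMap.mulRight ℂ c).rTensor A Z) * y := by
  induction Z with
  | zero => simp
  | add X Y hX hY => simp only [add_mul, map_add, hX, hY]
  | tmul a b => simp [smul_mul_assoc]

/-- Slicing the second leg commutes with left multiplication on the first, so non-degeneracy of `A`
applies to each slice. This cancels the factor `b ⊗ 1`. -/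
theorem eq_zero_of_map_mulLeft (h : ∀ a : A, (∀ b, b * a = 0) → a = 0) (Z : A ⊗[ℂ] A)
    (hZ : ∀ b, (LinearMap.mulLeft ℂ b).rTensor A Z = 0) : Z = 0 := by
  refine eq_zero_of_slices_right Z fun g => h _ fun b => ?_
  have key : ∀ Z : A ⊗[ℂ] A, b * TensorProduct.rid ℂ A (g.lTensor A Z) =
      TensorProduct.rid ℂ A (g.lTensor A ((LinearMap.mulLeft ℂ b).rTensor A Z)) := by
    intro Z
    induction Z with
    | zero => simp
    | add X Y hX hY => simp only [mul_add, map_add, hX, hY]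
    | tmul a c => simp [mul_smul_comm]
  rw [key, hZ, map_zero, map_zero]

end Multiplier

/-! ### From a finite-dimensional leg to a left unit. -/

namespace MultiplierHopfAlgebra

open Multiplier

variable {A : Type u} [NonUnitalRing A] [Module ℂ A] [IsScalarTower ℂ A A] [SMulCommClass ℂ A A]

theorem T₂_tmul_mul (H : MultiplierHopfAlgebra A) (b a : A) (x : A ⊗[ℂ] A) :
    H.T₂ (b ⊗ₜ a) * x = (LinearMap.mulLeft ℂ b).rTensor A ((H.comul a).left x) :=
  congrArg (fun m => left m x) (H.T₂_tmul b a)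

/-- If `δ(a)` lies in `M(A) ⊗ M(A)`, then the right leg of `(A ⊗ 1)δ(a)` is finite-dimensional. -/
theorem exists_finiteDimensional_right_leg (H : MultiplierHopfAlgebra A) {a : A}
    {X : Multiplier A ⊗[ℂ] Multiplier A} (hX : tensorMap A X = H.comul a) :
    ∃ W : Submodule ℂ A, FiniteDimensional ℂ W ∧ ∀ (b c : A) (φ : A →ₗ[ℂ] ℂ),
      TensorProduct.lid ℂ A
        ((φ ∘ₗ LinearMap.mulRight ℂ c).rTensor A (H.T₂ (b ⊗ₜ a))) ∈ W := by
  obtain ⟨F, hF, hFX⟩ := exists_finiteDimensional_slices_mem X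
  have hinj : Function.Injective (LinearMap.mul ℂ A) := by
    refine (injective_iff_map_eq_zero _).2 fun a ha => H.eq_zero_of_mul_right a fun b => ?_
    exact LinearMap.congr_fun ha b
  -- `W` consists of the elements whose left multiplication is the left action of some multiplier in
  -- `F`; by `hinj` it embeds in the image of `F`.
  refine ⟨(F.map leftLinear).comap (LinearMap.mul ℂ A), ?_, fun b c φ => ?_⟩
  · exact FiniteDimensional.of_injective
      ((LinearMap.mul ℂ A).restrict (p := (F.map leftLinear).comap (LinearMap.mul ℂ A))
        (q := F.map leftLinear) fun x hx => hx)
      fun x y hxy => Subtype.ext (hinj (congrArg Subtype.val hxy))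
  · refine ⟨_, hFX (evalFunctional (φ ∘ₗ LinearMap.mulLeft ℂ b) c), LinearMap.ext fun y => ?_⟩
    change left _ y = _ * y
    rw [← slice_mul_tmul, T₂_tmul_mul, ← slice_tensorMap_left, hX, LinearMap.rTensor_comp,
      LinearMap.comp_apply]

/-- If `δ(a)` lies in `M(A) ⊗ M(A)` for some `a ≠ 0`, and `A` has local units, then `A` has a left
unit. -/
theorem exists_left_unit (H : MultiplierHopfAlgebra A)
    (hunit : ∀ (W : Submodule ℂ A) [FiniteDimensional ℂ W], ∃ e : A, ∀ w ∈ W, w * e = w)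
    {a : A} (ha : a ≠ 0) {X : Multiplier A ⊗[ℂ] Multiplier A}
    (hX : tensorMap A X = H.comul a) : ∃ e : A, ∀ y, e * y = y := by
  obtain ⟨W, hW, hWmem⟩ := H.exists_finiteDimensional_right_leg hX
  obtain ⟨e, he⟩ := hunit W
  have hcomul : ∀ c y, (H.comul a).left (c ⊗ₜ (e * y - y)) = 0 := by
    refine fun c y => eq_zero_of_map_mulLeft H.eq_zero_of_mul_left _ fun b => ?_
    rw [← T₂_tmul_mul]
    refine eq_zero_of_slices_left _ fun φ => ?_
    -- With `w ∈ W` the slice from `hWmem`, the expression is `w(ey - y) = (we)y - wy = 0`.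
    rw [slice_mul_tmul, mul_sub, ← mul_assoc, he _ (hWmem b c φ), sub_self]
  refine ⟨e, fun y => ?_⟩
  have hT : H.T₁ (a ⊗ₜ (e * y - y)) = 0 := by
    refine tensor_eq_zero H.eq_zero_of_mul_right _ fun x => ?_
    rw [T₁_tmul_mul]
    induction x with
    | zero => simp
    | add x₁ x₂ h₁ h₂ => simp only [map_add, h₁, h₂, add_zero]
    | tmul c v =>
      -- Since `(ey - y)v = e(yv) - yv`, the vanishing at `yv` gives the one needed here.
      have h := hcomul c (y * v)
      rw [← mul_assoc, ← sub_mul] at h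
      exact h
  rw [LinearEquiv.map_eq_zero_iff] at hT
  -- A functional with `φ a ≠ 0` turns `a ⊗ (ey - y) = 0` into `φ(a)(ey - y) = 0`.
  obtain ⟨φ, hφ⟩ := not_forall.1 (mt (Module.forall_dual_apply_eq_zero_iff ℂ a).1 ha)
  have hs := congrArg (fun Z => TensorProduct.lid ℂ A (φ.rTensor A Z)) hT
  simp only [LinearMap.rTensor_tmul, TensorProduct.lid_tmul, map_zero] at hs
  exact sub_eq_zero.1 ((smul_eq_zero.1 hs).resolve_left hφ)

end MultiplierHopfAlgebra

/-- If `(A, δ)` is a discrete quantum group with `A` infinite-dimensional, then `(M(A), δ)` is not a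
Hopf algebra: the extension `δ : M(A) → M(A ⊗ A)` is not given by a Hopf algebra comultiplication
`M(A) → M(A) ⊗ M(A)`. -/
theorem mainTheorem5 {A : Type u} [NonUnitalRing A] [StarRing A] [Module ℂ A] [StarModule ℂ A]
    [IsScalarTower ℂ A A] [SMulCommClass ℂ A A] (G : DiscreteQuantumGroup A)
    (hA : ¬ FiniteDimensional ℂ A) :
    ¬ ∃ Δ : Multiplier A →ₐ[ℂ] Multiplier A ⊗[ℂ] Multiplier A,
      (∀ m, Multiplier.tensorMap A (Δ m) = G.comulExt m) ∧ IsHopfAlgebra Δ := by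
  rintro ⟨Δ, hΔ, -⟩
  have hne : ∃ a : A, a ≠ 0 := by
    by_contra! h
    have : Subsingleton A := ⟨fun x y => (h x).trans (h y).symm⟩
    exact hA inferInstance
  obtain ⟨a, ha⟩ := hne
  obtain ⟨e, he⟩ := G.exists_left_unit (fun W _ => G.isDirectSum.exists_right_unit W) ha
    ((hΔ (Multiplier.ι A a)).trans (G.comulExt_ι a))
  exact hA (G.isDirectSum.finiteDimensional he)
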